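/- Let $G$ be a finite simple connected graph with vertex set $V$ and distance $d$, and let $R : V\times V\to 2^V$ be a transit function, i.e. for all $u,v\in V$: $u\in R(u,v)$, $R(u,v)=R(v,u)$ and $R(u,u)=\{u\}$. Let $I_G(u,v)=\{w\in V : d(u,w)+d(w,v)=d(u,v)\}$ be the interval function of $G$. The graph $G$ is distance hereditary if the distances in every connected induced subgraph of $G$ are the same as in $G$. Then $G$ is distance hereditary and $R=I_G$ if and only if $R$ satisfies the following axioms, for all $u,v,x,y\in V$: - (b2) if $x\in R(u,v)$ and $y\in R(u,x)$, then $y\in R(u,v)$; - (b3) if $x\in R(u,v)$ and $y\in R(u,x)$, then $x\in R(y,v)$; - (J2) if $R(u,x)=\{u,x\}$, $R(x,v)=\{x,v\}$ and $R(u,v)\neq\{u,v\}$, then $x\in R(u,v)$; - (J2') if $x\in R(u,y)$, $y\in R(x,v)$, $R(u,x)=\{u,x\}$, $R(x,y)=\{x,y\}$, $R(y,v)=\{y,v\}$ and $R(u,v)\neq\{u,v\}$, then $x\in R(u,v)$; - (J3') if $x\in R(u,y)$, $y\in R(x,v)$, $R(x,y)\neq\{x,y\}$ and $R(u,v)\neq\{u,v\}$,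 then $x\in R(u,v)$; - and, moreover, for all distinct $u,v\in V$: $R(u,v)=\{u,v\}$ if and only if $uv\in E(G)$ (that is, $G$ is the underlying graph of $R$). -/

import Mathlib

/-- A transit function on `V` assigns to each pair of points a subset of `V` subject to the
axioms (t1), (t2), (t3). -/
structure IsTransitFunction {V : Type*} (R : V → V → Set V) : Prop where
  left_mem : ∀ u v, u ∈ R u v
  symm : ∀ u v, R u v = R v u
  self : ∀ u, R u u = {u}

/-- Axiom (b2). -/
def AxiomB2 {V : Type*} (R : V → V → Set V) : Prop :=
  ∀ u v x y, x ∈ R u v → y ∈ R u x → y ∈ R u v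

/-- Axiom (b3). -/
def AxiomB3 {V : Type*} (R : V → V → Set V) : Prop :=
  ∀ u v x y, x ∈ R u v → y ∈ R u x → x ∈ R y v

/-- Axiom (J2). -/
def AxiomJ2 {V : Type*} (R : V → V → Set V) : Prop :=
  ∀ u v x, R u x = {u, x} → R x v = {x, v} → R u v ≠ {u, v} → x ∈ R u v

/-- Axiom (J2'). -/
def AxiomJ2' {V : Type*} (R : V → V → Set V) : Prop :=
  ∀ u v x y, x ∈ R u y → y ∈ R x v →
    R u x = {u, x} → R x y = {x, y} → R y v = {y, v} → R u v ≠ {u, v} → x ∈ R u v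

/-- Axiom (J3'). -/
def AxiomJ3' {V : Type*} (R : V → V → Set V) : Prop :=
  ∀ u v x y, x ∈ R u y → y ∈ R x v → R x y ≠ {x, y} → R u v ≠ {u, v} → x ∈ R u v

namespace SimpleGraph

/-- The interval function `I_G`: the set of vertices lying on some shortest `u,v`-path.
It is used only for connected graphs, where `dist` is the standard distance. -/
def intervalFunction {V : Type*} (G : SimpleGraph V) (u v : V) : Set V :=
  {w | G.dist u w + G.dist w v = G.dist u v}

/-- A graph is distance hereditary if in every connected induced subgraph the distances are
the same as in the whole graph. -/
def IsDistanceHereditary {V : Type*} (G : SimpleGraph V) : Prop :=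
  ∀ s : Set V, (G.induce s).Connected →
    ∀ u v : s, (G.induce s).dist u v = G.dist (u : V) (v : V)

end SimpleGraph

/-! Both directions go through induced paths: a connected graph is distance hereditary exactly when
all its induced paths are geodesics. If `G` is distance hereditary, (b2), (b3) and (J2) for the
interval function are triangle inequalities. (J2') uses an induced path of length 3, and (J3') glues
geodesics sharing at least two edges (`dist_eq_sub`). Conversely, (b2) and the J-axioms put every
induced path inside the transit set of its ends (`mem_transit`), so intervals lie in `R`. A shortest
non-geodesic induced path would then contradict (b3) (`dist_eq_of_isInducedPath`). Once induced
paths are geodesics, induction on distance gives `R ⊆ I_G`. -/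

namespace SimpleGraph

/-! ### Induced paths -/

variable {V : Type*} {G : SimpleGraph V}

/-- `p 0, p 1, …, p n` is an induced path of `G`. -/
structure IsInducedPath (G : SimpleGraph V) (p : ℕ → V) (n : ℕ) : Prop where
  adj : ∀ i < n, G.Adj (p i) (p (i + 1))
  ne : ∀ i j, i + 1 < j → j ≤ n → p i ≠ p j
  not_adj : ∀ i j, i + 1 < j → j ≤ n → ¬ G.Adj (p i) (p j)

/-- The sequence `u, p 0, p 1, …`. -/
def seqCons (u : V) (p : ℕ → V) : ℕ → V
  | 0 => u
  | i + 1 => p i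

namespace IsInducedPath

variable {p : ℕ → V} {n : ℕ}

theorem shift (h : G.IsInducedPath p (n + 1)) : G.IsInducedPath (fun i => p (i + 1)) n where
  adj i hi := h.adj (i + 1) (by omega)
  ne i j hij hj := h.ne (i + 1) (j + 1) (by omega) (by omega)
  not_adj i j hij hj := h.not_adj (i + 1) (j + 1) (by omega) (by omega)

theorem mono {m : ℕ} (h : G.IsInducedPath p n) (hm : m ≤ n) : G.IsInducedPath p m where
  adj i hi := h.adj i (by omega)
  ne i j hij hj := h.ne i j hij (by omega)
  not_adj i j hij hj := h.not_adj i j hij (by omega)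

theorem cons {u : V} (h : G.IsInducedPath p n) (hu : G.Adj u (p 0))
    (hne : ∀ i, 0 < i → i ≤ n → u ≠ p i ∧ ¬ G.Adj u (p i)) :
    G.IsInducedPath (seqCons u p) (n + 1) where
  adj i hi := by
    cases i with
    | zero => exact hu
    | succ i => exact h.adj i (by omega)
  ne i j hij hj := by
    cases j with
    | zero => omega
    | succ j =>
      cases i with
      | zero => exact (hne j (by omega) (by omega)).1
      | succ i => exact h.ne i j (by omega) (by omega)
  not_adj i j hij hj := by
    cases j with
    | zero => omega
    | succ j =>
      cases i with
      | zero => exact (hne j (by omega) (by omega)).2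
      | succ i => exact h.not_adj i j (by omega) (by omega)

theorem le_of_eq (h : G.IsInducedPath p n) {i j : ℕ} (hj : j ≤ n) (hij : p i = p j) : j ≤ i := by
  by_contra! hlt
  rcases Nat.lt_or_ge (i + 1) j with h1 | h1
  · exact h.ne i j h1 hj hij
  · obtain rfl : j = i + 1 := by omega
    exact (h.adj i (by omega)).ne hij

/-- An edge inside an induced path raises the index by at most one, so its vertex set admits no
shortcut. -/
theorem le_add_length (h : G.IsInducedPath p n) {a b : p '' Set.Iic n}
    (w : (G.induce (p '' Set.Iic n)).Walk a b) :
    ∀ i j : ℕ, j ≤ n → p i = a → p j = b → j ≤ i + w.length := by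
  induction w with
  | nil =>
    intro i j hj hi hj'
    exact h.le_of_eq hj (hi.trans hj'.symm)
  | @cons a c b hac w ih =>
    intro i j hj hi hj'
    obtain ⟨k, hk, hkc⟩ := c.2
    have hadj : G.Adj (p i) (p k) := by rw [hi, hkc]; exact hac
    have hki : k ≤ i + 1 := by
      by_contra! hlt
      exact h.not_adj i k hlt hk hadj
    have := ih k j hj hkc hj'
    rw [Walk.length_cons]
    omega

theorem reachable_induce (h : G.IsInducedPath p n) :
    ∀ i (hi : i ≤ n), (G.induce (p '' Set.Iic n)).Reachable
      ⟨p 0, 0, Nat.zero_le n, rfl⟩ ⟨p i, i, hi, rfl⟩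
  | 0, _ => Reachable.refl _
  | i + 1, hi => (h.reachable_induce i (by omega)).trans
      (Adj.reachable (G := G.induce (p '' Set.Iic n)) (h.adj i (by omega)))

theorem dist_eq (h : G.IsInducedPath p n) (hG : G.IsDistanceHereditary) :
    G.dist (p 0) (p n) = n := by
  have hconn : (G.induce (p '' Set.Iic n)).Connected := by
    have : Nonempty (p '' Set.Iic n) := ⟨⟨p 0, 0, Nat.zero_le n, rfl⟩⟩
    refine ⟨fun a b => ?_⟩
    obtain ⟨_, i, hi, rfl⟩ := a
    obtain ⟨_, j, hj, rfl⟩ := b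
    exact (h.reachable_induce i hi).symm.trans (h.reachable_induce j hj)
  have hd := hG _ hconn ⟨p 0, 0, Nat.zero_le n, rfl⟩ ⟨p n, n, le_refl n, rfl⟩
  obtain ⟨w, hw⟩ := hconn.exists_walk_length_eq_dist
    ⟨p 0, 0, Nat.zero_le n, rfl⟩ ⟨p n, n, le_refl n, rfl⟩
  have hge := h.le_add_length w 0 n le_rfl rfl rfl
  have hle : ∀ k ≤ n, G.dist (p 0) (p k) ≤ k := by
    intro k
    induction k with
    | zero => intro _; simp
    | succ k ih =>
      intro hk
      have h1 := ih (by omega)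
      have h2 := (h.adj k (by omega)).reachable.dist_triangle_right (p 0)
      have h3 := dist_eq_one_iff_adj.2 (h.adj k (by omega))
      omega
  have := hle n le_rfl
  simp only at hd
  omega

end IsInducedPath

/-! ### Geodesics and their gluing -/

theorem dist_le_sub_of_adj (hG : G.Connected) {p : ℕ → V} {n : ℕ}
    (hp : ∀ i < n, G.Adj (p i) (p (i + 1))) {i j : ℕ} (hij : i ≤ j) (hj : j ≤ n) :
    G.dist (p i) (p j) ≤ j - i := by
  induction j, hij using Nat.le_induction with
  | base => simp
  | succ j hij ih =>
    have h1 := ih (by omega)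
    have h2 := hG.dist_triangle (u := p i) (v := p j) (w := p (j + 1))
    have h3 := dist_eq_one_iff_adj.2 (hp j (by omega))
    omega

theorem dist_eq_sub_of_subpath (hG : G.Connected) {p : ℕ → V} {n : ℕ}
    (hp : ∀ i < n, G.Adj (p i) (p (i + 1))) {s t i j : ℕ} (ht : t ≤ n)
    (hst : G.dist (p s) (p t) = t - s) (hsi : s ≤ i) (hij : i ≤ j) (hjt : j ≤ t) :
    G.dist (p i) (p j) = j - i := by
  have h1 := dist_le_sub_of_adj hG hp hsi (by omega)
  have h2 := dist_le_sub_of_adj hG hp hij (by omega)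
  have h3 := dist_le_sub_of_adj hG hp hjt (by omega)
  have h4 := hG.dist_triangle (u := p s) (v := p i) (w := p t)
  have h5 := hG.dist_triangle (u := p i) (v := p j) (w := p t)
  omega

theorem one_lt_dist (hG : G.Connected) {u v : V} :
    1 < G.dist u v ↔ u ≠ v ∧ ¬ G.Adj u v := by
  rw [← dist_eq_one_iff_adj, Ne, ← hG.dist_eq_zero_iff]
  omega

theorem IsInducedPath.of_dist (hG : G.Connected) {p : ℕ → V} {n : ℕ}
    (hp : ∀ i < n, G.Adj (p i) (p (i + 1)))
    (hd : ∀ i j, i + 1 < j → j ≤ n → 1 < G.dist (p i) (p j)) : G.IsInducedPath p n where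
  adj := hp
  ne i j hij hj := ((one_lt_dist hG).1 (hd i j hij hj)).1
  not_adj i j hij hj := ((one_lt_dist hG).1 (hd i j hij hj)).2

theorem exists_geodesic (hG : G.Connected) (u v : V) :
    ∃ p : ℕ → V, p 0 = u ∧ p (G.dist u v) = v ∧ G.IsInducedPath p (G.dist u v) ∧
      ∀ i j, i ≤ j → j ≤ G.dist u v → G.dist (p i) (p j) = j - i := by
  obtain ⟨w, hw⟩ := hG.exists_walk_length_eq_dist u v
  have hn : w.getVert (G.dist u v) = v := by rw [← hw]; exact w.getVert_length
  have hp : ∀ i < G.dist u v, G.Adj (w.getVert i) (w.getVert (i + 1)) := fun i hi =>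
    w.adj_getVert_succ (by omega)
  have hd : ∀ i j, i ≤ j → j ≤ G.dist u v → G.dist (w.getVert i) (w.getVert j) = j - i :=
    fun i j hij hj => dist_eq_sub_of_subpath hG hp (s := 0) le_rfl
      (by rw [hn, w.getVert_zero]; rfl) (Nat.zero_le i) hij hj
  exact ⟨w.getVert, w.getVert_zero, hn, .of_dist hG hp fun i j hij hj => by
    rw [hd i j (by omega) hj]; omega, hd⟩

/-- In a distance hereditary graph, two geodesics that overlap in at least two edges
glue to a geodesic. -/
theorem IsDistanceHereditary.dist_eq_sub (hDH : G.IsDistanceHereditary) (hG : G.Connected)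
    {p : ℕ → V} {n s t : ℕ} (hp : ∀ i < n, G.Adj (p i) (p (i + 1))) (hst : s + 2 ≤ t)
    (ht : t ≤ n) (h0 : G.dist (p 0) (p t) = t) (hn : G.dist (p s) (p n) = n - s) :
    ∀ k i j, j = i + k → j ≤ n → G.dist (p i) (p j) = k := by
  intro k
  induction k using Nat.strong_induction_on with
  | _ k ih =>
    rintro i j hk hj
    by_cases hjt : j ≤ t
    · rw [dist_eq_sub_of_subpath hG hp ht (s := 0) (by simpa using h0) (Nat.zero_le i)
        (by omega) hjt]
      omega
    by_cases his : s ≤ i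
    · rw [dist_eq_sub_of_subpath hG hp le_rfl hn his (by omega) hj]
      omega
    -- Now `i < s` and `t < j`, so `k ≥ 4`. If `p i` and `p j` were adjacent, going round the cycle
    -- from `p i` via `p j` down to `p (i + 2)` would be an induced path of length `k - 1`, but
    -- these ends are at distance 2.
    by_cases hadj : G.Adj (p i) (p j)
    · have hind : G.IsInducedPath (fun a => p (j - a)) (k - 2) := by
        refine .of_dist hG (fun a ha => ?_) fun a b hab hb => ?_
        · have := hp (j - (a + 1)) (by omega)
          rw [show j - (a + 1) + 1 = j - a by omega] at this
          exact this.symm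
        · rw [dist_comm, ih (b - a) (by omega) (j - b) (j - a) (by omega) (by omega)]
          omega
      have h1 := (hind.cons (u := p i) hadj fun a ha hak => by
        rw [← one_lt_dist hG]
        rw [ih (k - a) (by omega) i (j - a) (by omega) (by omega)]
        omega).dist_eq hDH
      have h2 : G.dist (p i) (p (j - (k - 2))) = k - 2 + 1 := h1
      rw [ih 2 (by omega) i (j - (k - 2)) (by omega) (by omega)] at h2
      omega
    · have hne : p i ≠ p j := by
        intro h
        have h1 := ih (k - 1) (by omega) (i + 1) j (by omega) hj
        rw [← h, dist_comm, ih 1 (by omega) i (i + 1) rfl (by omega)] at h1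
        omega
      have hind : G.IsInducedPath (fun a => p (i + a)) k := by
        refine .of_dist hG (fun a ha => hp (i + a) (by omega)) fun a b hab hb => ?_
        by_cases hk' : b - a < k
        · rw [ih (b - a) hk' (i + a) (i + b) (by omega) (by omega)]
          omega
        · obtain rfl : a = 0 := by omega
          obtain rfl : b = k := by omega
          rw [← hk]
          exact (one_lt_dist hG).2 ⟨hne, hadj⟩
      have := hind.dist_eq hDH
      simpa [← hk] using this

theorem IsDistanceHereditary.dist_eq_add_add (hDH : G.IsDistanceHereditary) (hG : G.Connected)
    {u v x y : V} (hx : G.dist u x + G.dist x y = G.dist u y)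
    (hy : G.dist x y + G.dist y v = G.dist x v) (hxy : 2 ≤ G.dist x y) :
    G.dist u v = G.dist u x + G.dist x y + G.dist y v := by
  obtain ⟨w₁, h₁⟩ := hG.exists_walk_length_eq_dist u x
  obtain ⟨w₂, h₂⟩ := hG.exists_walk_length_eq_dist x y
  obtain ⟨w₃, h₃⟩ := hG.exists_walk_length_eq_dist y v
  set W := w₁.append (w₂.append w₃) with hW
  have hlen : W.length = G.dist u x + G.dist x y + G.dist y v := by
    simp [hW, h₁, h₂, h₃, add_assoc]
  have ha : W.getVert (G.dist u x) = x := by simp [hW, Walk.getVert_append, h₁]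
  have hb : W.getVert (G.dist u x + G.dist x y) = y := by
    simp [hW, Walk.getVert_append, h₁, h₂]
  have hv : W.getVert W.length = v := W.getVert_length
  have := hDH.dist_eq_sub hG (p := W.getVert) (n := W.length) (s := G.dist u x)
    (t := G.dist u x + G.dist x y) (fun i hi => W.adj_getVert_succ hi) (by omega) (by omega)
    (by rw [hb, W.getVert_zero, hx]) (by rw [ha, hv, hlen, ← hy]; omega)
    W.length 0 W.length (by omega) le_rfl
  rwa [hv, W.getVert_zero, hlen] at this

/-! ### Axioms for the interval function -/

theorem mem_intervalFunction {u v w : V} :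
    w ∈ G.intervalFunction u v ↔ G.dist u w + G.dist w v = G.dist u v := Iff.rfl

theorem intervalFunction_eq_pair_iff (hG : G.Connected) (u v : V) :
    G.intervalFunction u v = {u, v} ↔ G.dist u v ≤ 1 := by
  constructor
  · intro h
    by_contra! hlt
    obtain ⟨p, h0, hn, -, hd⟩ := exists_geodesic hG u v
    have h1 := hd 0 1 (by omega) (by omega)
    have h2 := hd 1 _ (by omega) le_rfl
    rw [h0] at h1
    rw [hn] at h2
    have hmem : p 1 ∈ G.intervalFunction u v := by
      rw [mem_intervalFunction]; omega
    rw [h] at hmem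
    rcases hmem with hm | hm
    · rw [hm, dist_self] at h1; omega
    · rw [hm, dist_self] at h2; omega
  · intro h
    ext w
    simp only [mem_intervalFunction, Set.mem_insert_iff, Set.mem_singleton_iff]
    constructor
    · intro hw
      rw [eq_comm, ← hG.dist_eq_zero_iff, ← hG.dist_eq_zero_iff]
      omega
    · rintro (rfl | rfl) <;> simp

theorem axiomB2_intervalFunction (hG : G.Connected) : AxiomB2 G.intervalFunction := by
  intro u v x y hx hy
  rw [mem_intervalFunction] at *
  have h1 := hG.dist_triangle (u := y) (v := x) (w := v)
  have h2 := hG.dist_triangle (u := u) (v := y) (w := v)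
  omega

theorem axiomB3_intervalFunction (hG : G.Connected) : AxiomB3 G.intervalFunction := by
  intro u v x y hx hy
  rw [mem_intervalFunction] at *
  have h1 := hG.dist_triangle (u := y) (v := x) (w := v)
  have h2 := hG.dist_triangle (u := u) (v := y) (w := v)
  omega

theorem axiomJ2_intervalFunction (hG : G.Connected) : AxiomJ2 G.intervalFunction := by
  intro u v x hx hy h
  rw [Ne, intervalFunction_eq_pair_iff hG] at h
  rw [intervalFunction_eq_pair_iff hG] at hx hy
  rw [mem_intervalFunction]
  have h1 := hG.dist_triangle (u := u) (v := x) (w := v)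
  omega

theorem IsDistanceHereditary.axiomJ2'_intervalFunction (hDH : G.IsDistanceHereditary)
    (hG : G.Connected) : AxiomJ2' G.intervalFunction := by
  intro u v x y hx hy hux hxy hyv h
  rw [Ne, intervalFunction_eq_pair_iff hG] at h
  rw [intervalFunction_eq_pair_iff hG] at hux hxy hyv
  rw [mem_intervalFunction] at *
  have h1 := hG.dist_triangle (u := u) (v := x) (w := v)
  by_cases hall : G.dist u x = 1 ∧ G.dist x y = 1 ∧ G.dist y v = 1
  · obtain ⟨a, b, c⟩ := hall
    have h0 : G.IsInducedPath (fun _ => v) 0 := ⟨by omega, by omega, by omega⟩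
    have h1 := h0.cons (u := y) (dist_eq_one_iff_adj.1 c) (by omega)
    have h2 := h1.cons (u := x) (dist_eq_one_iff_adj.1 b) fun i hi hi' => by
      obtain rfl : i = 1 := by omega
      rw [← one_lt_dist hG]
      change 1 < G.dist x v
      omega
    have h3 := (h2.cons (u := u) (dist_eq_one_iff_adj.1 a) fun i hi hi' => by
      rw [← one_lt_dist hG]
      obtain rfl | rfl : i = 1 ∨ i = 2 := by omega
      · change 1 < G.dist u y
        omega
      · change 1 < G.dist u v
        omega).dist_eq hDH
    change G.dist u v = 3 at h3
    omega
  -- Some step is trivial, so `u, x, y, v` has length at most 2, while `u` and `v` are at distance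
  -- at least 2.
  · have h2 := hG.dist_triangle (u := u) (v := y) (w := v)
    omega

theorem IsDistanceHereditary.axiomJ3'_intervalFunction (hDH : G.IsDistanceHereditary)
    (hG : G.Connected) : AxiomJ3' G.intervalFunction := by
  intro u v x y hx hy hxy _
  rw [Ne, intervalFunction_eq_pair_iff hG] at hxy
  rw [mem_intervalFunction] at *
  have := hDH.dist_eq_add_add hG hx hy (by omega)
  omega

/-- A geodesic of an induced subgraph is an induced path of `G`. -/
theorem isDistanceHereditary_of_isInducedPath
    (h : ∀ p n, G.IsInducedPath p n → G.dist (p 0) (p n) = n) : G.IsDistanceHereditary := by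
  intro s hs u v
  obtain ⟨p, h0, hn, hp, -⟩ := exists_geodesic hs u v
  have := h (fun i => (p i : V)) _
    ⟨hp.adj, fun i j hij hj => Subtype.coe_injective.ne (hp.ne i j hij hj), hp.not_adj⟩
  rw [← this]
  simp only [h0, hn]

end SimpleGraph

/-! ### From the axioms to the interval function -/

section TransitFunction

open SimpleGraph

variable {V : Type*} {G : SimpleGraph V} {R : V → V → Set V}

theorem IsTransitFunction.eq_pair_iff (hR : IsTransitFunction R)
    (hE : ∀ u v : V, u ≠ v → (R u v = {u, v} ↔ G.Adj u v)) (u v : V) :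
    R u v = {u, v} ↔ u = v ∨ G.Adj u v := by
  by_cases h : u = v
  · subst h; simp [hR.self]
  · simp [h, hE u v h]

theorem IsTransitFunction.right_mem (hR : IsTransitFunction R) (u v : V) : v ∈ R u v := by
  rw [hR.symm]; exact hR.left_mem v u

theorem IsTransitFunction.mem_symm (hR : IsTransitFunction R) {u v w : V} (h : w ∈ R u v) :
    w ∈ R v u := by
  rwa [hR.symm]

/-- Axiom (b3) implies axiom (b1). -/
theorem IsTransitFunction.eq_of_mem_of_mem (hR : IsTransitFunction R) (h3 : AxiomB3 R)
    {u v x : V} (hx : x ∈ R u v) (hv : v ∈ R u x) : x = v := by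
  have := h3 u v x v hx hv
  rwa [hR.self] at this

theorem SimpleGraph.IsInducedPath.mem_transit (hR : IsTransitFunction R) (h2 : AxiomB2 R)
    (hJ2 : AxiomJ2 R) (hJ2' : AxiomJ2' R) (hJ3' : AxiomJ3' R)
    (hE : ∀ u v : V, u ≠ v → (R u v = {u, v} ↔ G.Adj u v)) :
    ∀ n (p : ℕ → V), G.IsInducedPath p n → ∀ i ≤ n, p i ∈ R (p 0) (p n) := by
  have hP := hR.eq_pair_iff hE
  intro n
  induction n using Nat.strong_induction_on with
  | _ n ih =>
    intro p hp i hi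
    rcases Nat.eq_zero_or_pos i with rfl | hi0
    · exact hR.left_mem _ _
    obtain ⟨n, rfl⟩ : ∃ m, n = m + 1 := ⟨n - 1, by omega⟩
    have hmem : ∀ i, 1 ≤ i → i ≤ n + 1 → p i ∈ R (p 1) (p (n + 1)) := fun i h1 hi => by
      have := ih n (by omega) _ hp.shift (i - 1) (by omega)
      simpa [Nat.sub_add_cancel h1] using this
    -- By (b2) at the far end, the first inner vertex brings in all the others.
    suffices h : p 1 ∈ R (p 0) (p (n + 1)) from
      hR.mem_symm (h2 _ _ _ _ (hR.mem_symm h) (hR.mem_symm (hmem i hi0 hi)))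
    have hadj : ∀ j < n + 1, R (p j) (p (j + 1)) = {p j, p (j + 1)} := fun j hj =>
      (hP _ _).2 (Or.inr (hp.adj j hj))
    have hnadj : ∀ j k, j + 1 < k → k ≤ n + 1 → R (p j) (p k) ≠ {p j, p k} := by
      intro j k hjk hk h
      rcases (hP _ _).1 h with h | h
      · exact hp.ne j k hjk hk h
      · exact hp.not_adj j k hjk hk h
    rcases n with _ | _ | n
    · exact hR.right_mem _ _
    · exact hJ2 _ _ _ (hadj 0 (by omega)) (hadj 1 (by omega)) (hnadj 0 2 (by omega) (by omega))
    · have hx : p 1 ∈ R (p 0) (p (n + 2)) :=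
        ih (n + 2) (by omega) p (hp.mono (by omega)) 1 (by omega)
      have hy : p (n + 2) ∈ R (p 1) (p (n + 3)) := hmem (n + 2) (by omega) (by omega)
      have hn := hnadj 0 (n + 3) (by omega) (by omega)
      rcases n with _ | n
      · exact hJ2' _ _ _ _ hx hy (hadj 0 (by omega)) (hadj 1 (by omega)) (hadj 2 (by omega)) hn
      · exact hJ3' _ _ _ _ hx hy (hnadj 1 (n + 3) (by omega) (by omega)) hn

theorem IsTransitFunction.mem_of_mem_intervalFunction (hG : G.Connected)
    (hmem : ∀ n (p : ℕ → V), G.IsInducedPath p n → ∀ i ≤ n, p i ∈ R (p 0) (p n)) {u v w : V}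
    (hw : w ∈ G.intervalFunction u v) : w ∈ R u v := by
  rw [mem_intervalFunction] at hw
  obtain ⟨w₁, h₁⟩ := hG.exists_walk_length_eq_dist u w
  obtain ⟨w₂, h₂⟩ := hG.exists_walk_length_eq_dist w v
  set W := w₁.append w₂ with hW
  have hlen : W.length = G.dist u v := by simp [hW, h₁, h₂, hw]
  have hW₁ : W.getVert (G.dist u w) = w := by simp [hW, Walk.getVert_append, h₁]
  have hv : W.getVert W.length = v := W.getVert_length
  have hp : ∀ i < W.length, G.Adj (W.getVert i) (W.getVert (i + 1)) := fun i hi =>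
    W.adj_getVert_succ hi
  have hind : G.IsInducedPath W.getVert W.length := .of_dist hG hp fun i j hij hj => by
    rw [dist_eq_sub_of_subpath hG hp (s := 0) le_rfl
      (by rw [hv, W.getVert_zero, hlen]; rfl) (Nat.zero_le i) (by omega) hj]
    omega
  have := hmem _ _ hind (G.dist u w) (by omega)
  rwa [hW₁, hv, W.getVert_zero] at this

theorem IsTransitFunction.dist_eq_of_isInducedPath (hG : G.Connected)
    (hR : IsTransitFunction R) (h3 : AxiomB3 R)
    (hE : ∀ u v : V, u ≠ v → (R u v = {u, v} ↔ G.Adj u v))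
    (hmem : ∀ n (p : ℕ → V), G.IsInducedPath p n → ∀ i ≤ n, p i ∈ R (p 0) (p n))
    (p : ℕ → V) (n : ℕ) (hp : G.IsInducedPath p n) : G.dist (p 0) (p n) = n := by
  induction n with
  | zero => simp
  | succ n ih =>
    have hd := ih (hp.mono (by omega))
    have hyv := hp.adj n (by omega)
    have hyv1 := dist_eq_one_iff_adj.2 hyv
    have hle := hG.dist_triangle (u := p 0) (v := p n) (w := p (n + 1))
    by_contra hne
    have hy : p n ∈ R (p 0) (p (n + 1)) := hmem _ _ hp n (by omega)
    obtain ⟨q, hq0, hqm, hq, hqd⟩ := exists_geodesic hG (p (n + 1)) (p 0)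
    set m := G.dist (p (n + 1)) (p 0) with hm
    rw [SimpleGraph.dist_comm, ← hm] at hle hne
    have hm0 : 0 < m := by
      rw [hm]
      apply hG.pos_dist_of_ne
      rcases n with _ | n
      · exact hyv.ne'
      · exact (hp.ne 0 (n + 2) (by omega) le_rfl).symm
    have hvz := hq.adj 0 hm0
    rw [hq0] at hvz
    have hzu := hqd 1 m hm0 le_rfl
    rw [hqm] at hzu
    have hzy : q 1 ≠ p n := by
      intro h
      rw [h, dist_comm, hd] at hzu
      omega
    -- Otherwise (b3) would put `p n` in the transit set of an edge it is not an end of.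
    have hz : q 1 ∉ G.intervalFunction (p 0) (p n) := by
      intro h
      have h1 := h3 _ _ _ _ hy (mem_of_mem_intervalFunction hG hmem h)
      rw [(hE _ _ hvz.ne').2 hvz.symm] at h1
      rcases h1 with h1 | h1
      · exact hzy h1.symm
      · exact hyv.ne h1
    rw [mem_intervalFunction] at hz
    have h1 := hG.dist_triangle (u := p 0) (v := q 1) (w := p n)
    have hc : G.dist (p 0) (q 1) = G.dist (q 1) (p 0) := SimpleGraph.dist_comm
    have hyz : G.dist (p n) (q 1) = G.dist (q 1) (p n) := SimpleGraph.dist_comm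
    have h2 := hG.dist_triangle (u := q 1) (v := p (n + 1)) (w := p n)
    rw [dist_eq_one_iff_adj.2 hyv.symm, dist_eq_one_iff_adj.2 hvz.symm] at h2
    have hmn : m = n := by omega
    -- As `m = n` and `q 1` is at distance 2 from `p n`, prepending `p n` to `q` keeps it induced;
    -- then `p n` and `p (n + 1)` each lie between the other and `p 0`.
    have hind := hq.cons (u := p n) (by rwa [hq0]) fun i hi him => by
      rw [← one_lt_dist hG]
      have h2 := hG.dist_triangle (u := p n) (v := q i) (w := p 0)
      have h3 := hqd i m him le_rfl
      rw [hqm] at h3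
      have hd' : G.dist (p n) (p 0) = n := by rw [SimpleGraph.dist_comm, hd]
      rcases Nat.lt_or_ge 1 i with hi1 | hi1
      · omega
      · obtain rfl : i = 1 := by omega
        omega
    have hv : p (n + 1) ∈ R (p n) (p 0) := by
      have : q 0 ∈ R (p n) (q m) := hmem _ _ hind 1 (by omega)
      rwa [hq0, hqm] at this
    exact hyv.ne (hR.eq_of_mem_of_mem h3 hy (hR.mem_symm hv))

/-- By (b3), `x` lies between `u` and each vertex of an `x,v`-geodesic, so `u` has no other
neighbour there and prepending it gives an induced path. -/
theorem IsTransitFunction.dist_eq_succ_of_mem_of_adj (hG : G.Connected)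
    (hR : IsTransitFunction R) (h3 : AxiomB3 R)
    (hE : ∀ u v : V, u ≠ v → (R u v = {u, v} ↔ G.Adj u v))
    (hmem : ∀ n (p : ℕ → V), G.IsInducedPath p n → ∀ i ≤ n, p i ∈ R (p 0) (p n))
    {u v x : V} (hux : G.Adj u x) (hx : x ∈ R u v) : G.dist u v = G.dist x v + 1 := by
  obtain ⟨q, hq0, hqm, hq, hqd⟩ := exists_geodesic hG x v
  have hind := hq.cons (u := u) (by rwa [hq0]) fun i hi him => by
    have hqi : q i ∈ R x v := by
      have := hmem _ _ hq i him
      rwa [hq0, hqm] at this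
    have hxi : x ∈ R (q i) u := h3 _ _ _ _ (hR.mem_symm hx) (hR.mem_symm hqi)
    have hne : x ≠ q i := by
      intro h
      have := hqd 0 i (by omega) him
      rw [hq0, ← h, dist_self] at this
      omega
    refine ⟨?_, fun h => ?_⟩
    · rintro rfl
      rw [hR.self] at hxi
      exact hne hxi
    · rw [(hE _ _ h.ne').2 h.symm] at hxi
      rcases hxi with hxi | hxi
      · exact hne hxi
      · exact hux.ne' hxi
  have : G.dist u (q (G.dist x v)) = G.dist x v + 1 :=
    hR.dist_eq_of_isInducedPath hG h3 hE hmem _ _ hind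
  rwa [hqm] at this

theorem IsTransitFunction.eq_intervalFunction (hG : G.Connected)
    (hR : IsTransitFunction R) (h2 : AxiomB2 R) (h3 : AxiomB3 R)
    (hE : ∀ u v : V, u ≠ v → (R u v = {u, v} ↔ G.Adj u v))
    (hmem : ∀ n (p : ℕ → V), G.IsInducedPath p n → ∀ i ≤ n, p i ∈ R (p 0) (p n)) :
    R = G.intervalFunction := by
  -- Induction moves `u` one step towards `w`: (b3) keeps `w` in the smaller transit set, (b2) makes
  -- the step reduce the distance to `v`.
  have key : ∀ k u v w, G.dist u w = k → w ∈ R u v → w ∈ G.intervalFunction u v := by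
    intro k
    induction k with
    | zero =>
      intro u v w hk hw
      rw [hG.dist_eq_zero_iff] at hk
      subst hk
      simp [mem_intervalFunction]
    | succ k ih =>
      intro u v w hk hw
      obtain ⟨p, h0, hn, hp, hd⟩ := exists_geodesic hG u w
      have hx : p 1 ∈ R u w := by
        have := hmem _ _ hp 1 (by omega)
        rwa [h0, hn] at this
      have hux : G.Adj (p 0) (p 1) := hp.adj 0 (by omega)
      have hxw := hd 1 _ (by omega) le_rfl
      rw [h0] at hux
      rw [hn] at hxw
      have h1 := ih (p 1) v w (by omega) (h3 _ _ _ _ hw hx)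
      have h4 := hR.dist_eq_succ_of_mem_of_adj hG h3 hE hmem hux (h2 _ _ _ _ hw hx)
      rw [mem_intervalFunction] at *
      omega
  ext u v w
  exact ⟨key _ u v w rfl, mem_of_mem_intervalFunction hG hmem⟩

end TransitFunction

theorem mainTheorem1 {V : Type*} [Finite V] (G : SimpleGraph V) (hG : G.Connected)
    (R : V → V → Set V) (hR : IsTransitFunction R) :
    (G.IsDistanceHereditary ∧ R = G.intervalFunction) ↔
      (AxiomB2 R ∧ AxiomB3 R ∧ AxiomJ2 R ∧ AxiomJ2' R ∧ AxiomJ3' R ∧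
        ∀ u v : V, u ≠ v → (R u v = {u, v} ↔ G.Adj u v)) := by
  constructor
  · rintro ⟨hDH, rfl⟩
    refine ⟨SimpleGraph.axiomB2_intervalFunction hG, SimpleGraph.axiomB3_intervalFunction hG,
      SimpleGraph.axiomJ2_intervalFunction hG, hDH.axiomJ2'_intervalFunction hG,
      hDH.axiomJ3'_intervalFunction hG, fun u v huv => ?_⟩
    rw [SimpleGraph.intervalFunction_eq_pair_iff hG, ← SimpleGraph.dist_eq_one_iff_adj]
    have := hG.pos_dist_of_ne huv
    omega
  · rintro ⟨h2, h3, hJ2, hJ2', hJ3', hE⟩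
    have hmem := SimpleGraph.IsInducedPath.mem_transit hR h2 hJ2 hJ2' hJ3' hE
    exact ⟨SimpleGraph.isDistanceHereditary_of_isInducedPath
      (hR.dist_eq_of_isInducedPath hG h3 hE hmem), hR.eq_intervalFunction hG h2 h3 hE hmem⟩
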